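/- Let $N$ parties share systems with finite-dimensional Hilbert spaces. For a (not necessarily normalized) pure state $|\psi\rangle\in\mathbb C^{d_1}\otimes\cdots\otimes\mathbb C^{d_N}$ and a multi-index $\mathbf k=(k_1,\dots,k_N)$ with $1\le k_i\le d_i$, put $$E_{\mathbf k}(|\psi\rangle)=\max_{\Gamma_1,\dots,\Gamma_N}\bigl\|(\Gamma_1\otimes\cdots\otimes\Gamma_N)|\psi\rangle\bigr\|^2 ,$$ where $\Gamma_i$ runs over the orthogonal projectors of rank $k_i$ on $\mathbb C^{d_i}$. An LOCC protocol consists of finitely many rounds; in each round one party applies to its own system a quantum instrument (finitely many outcomes, each a completely positive map with finitely many Kraus operators, the sum of the maps being trace preserving; the local dimension may change), and announces the outcome to all parties, on which the later rounds may depend. Each branch ends by declaring success or failure. We say that $|\psi\rangle$ can be converted into $|\chi\rangle$ via SLOCC if, for some LOCC protocol and some $p>0$, starting from $|\psi\rangle\langle\psi|$ the unnormalized final state on success is $p\,|\chi\rangle\langle\chi|$ (that is, with probability $p>0$ success is declared and the parties then share $|\chi\rangle$). Let $|\psi\rangle\in\mathbb C^{d_1}\otimes\cdots\otimes\mathbb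 C^{d_N}$ and $|\chi\rangle\in\mathbb C^{t_1}\otimes\cdots\otimes\mathbb C^{t_N}$ be normalized pure states (in particular, one may take $t_i=d_i$ for all $i$), and let $\mathbf k$ be a multi-index with $1\le k_i\le\min(d_i,t_i)$ for all $i$. If $E_{\mathbf k}(|\psi\rangle)=1$ and $E_{\mathbf k}(|\chi\rangle)\ne 1$, then $|\psi\rangle$ cannot be converted into $|\chi\rangle$ via SLOCC. -/

import Mathlib

open scoped Matrix BigOperators

noncomputable section

/-- Labels of the product basis of `ℂ^(d 0) ⊗ ⋯ ⊗ ℂ^(d (N-1))`. -/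
abbrev Conf {N : ℕ} (d : Fin N → ℕ) : Type := ∀ i : Fin N, Fin (d i)

/-- The `N`-partite Hilbert space `ℂ^(d 0) ⊗ ⋯ ⊗ ℂ^(d (N-1))`, in coordinates with respect to the
(orthonormal) product basis. -/
abbrev PartySpace {N : ℕ} (d : Fin N → ℕ) : Type := EuclideanSpace ℂ (Conf d)

/-- The matrix of `A 0 ⊗ ⋯ ⊗ A (N-1)` in the product bases. -/
def tensorOp {N : ℕ} {d e : Fin N → ℕ} (A : ∀ i, Matrix (Fin (e i)) (Fin (d i)) ℂ) :
    Matrix (Conf e) (Conf d) ℂ :=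
  Matrix.of fun x y => ∏ i, A i (x i) (y i)

/-- The values `‖(Γ 0 ⊗ ⋯ ⊗ Γ (N-1)) ψ‖²`, where `Γ i` runs over the orthogonal projectors of
rank `k i` on system `i`. -/
def projectionValues {N : ℕ} {d : Fin N → ℕ} (k : Fin N → ℕ) (ψ : PartySpace d) : Set ℝ :=
  {r | ∃ Γ : ∀ i, Matrix (Fin (d i)) (Fin (d i)) ℂ,
    (∀ i, IsStarProjection (Γ i) ∧ (Γ i).rank = k i) ∧
    r = ‖(WithLp.toLp 2 (tensorOp Γ *ᵥ ψ.ofLp) : PartySpace d)‖ ^ 2}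

/-- The quantity `E_k` of a (not necessarily normalized) pure state: the maximum of
`‖(Γ 0 ⊗ ⋯ ⊗ Γ (N-1)) ψ‖²` over local projectors of ranks `k i`.  It is meaningful
for `k i ≤ d i`, when the set of values is nonempty and compact. -/
def multiE {N : ℕ} {d : Fin N → ℕ} (k : Fin N → ℕ) (ψ : PartySpace d) : ℝ :=
  sSup (projectionValues k ψ)

/-- The density operator `|ψ⟩⟨ψ|`. -/
def ketBra {N : ℕ} {d : Fin N → ℕ} (ψ : PartySpace d) : Matrix (Conf d) (Conf d) ℂ :=
  Matrix.vecMulVec ψ.ofLp (star ψ.ofLp)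

/-- The operator acting as `K` on system `i` and as the identity on every other system.
Intended for `e j = d j` whenever `j ≠ i`; then the off-`i` factors are identity matrices. -/
def localOp {N : ℕ} {d e : Fin N → ℕ} (i : Fin N) (K : Matrix (Fin (e i)) (Fin (d i)) ℂ) :
    Matrix (Conf e) (Conf d) ℂ :=
  tensorOp (Function.update
    (fun j => Matrix.of fun (a : Fin (e j)) (b : Fin (d j)) => if (a : ℕ) = (b : ℕ) then 1 else 0)
    i K)

/-- A quantum instrument performed by party `i`: finitely many outcomes `m`, each given by a
completely positive map in Kraus form, summing to a trace-preserving map.  The dimension of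
system `i` may change (ancillas may be adjoined or discarded), in a way that may depend on
the outcome; the other systems are unchanged. -/
structure LocalInstrument {N : ℕ} (d : Fin N → ℕ) (i : Fin N) where
  numOutcomes : ℕ
  outDim : Fin numOutcomes → Fin N → ℕ
  outDim_eq : ∀ m j, j ≠ i → outDim m j = d j
  numKraus : Fin numOutcomes → ℕ
  kraus : ∀ m, Fin (numKraus m) → Matrix (Fin (outDim m i)) (Fin (d i)) ℂ
  complete : ∑ m, ∑ s, (kraus m s)ᴴ * kraus m s = 1

/-- The (unnormalized) state after outcome `m`, when the initial state is `ρ`. -/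
def LocalInstrument.apply {N : ℕ} {d : Fin N → ℕ} {i : Fin N} (I : LocalInstrument d i)
    (m : Fin I.numOutcomes) (ρ : Matrix (Conf d) (Conf d) ℂ) :
    Matrix (Conf (I.outDim m)) (Conf (I.outDim m)) ℂ :=
  ∑ s, localOp i (I.kraus m s) * ρ * (localOp i (I.kraus m s))ᴴ

/-- An LOCC protocol on systems of dimensions `d` that aims at a state of systems of dimensions `t`.
In each round one party performs an instrument and announces the outcome to all parties, and the
continuation of the protocol (who acts next, and how) depends on the outcomes announced so far.
Every branch ends by declaring success or failure. -/
inductive LOCCProtocol {N : ℕ} (t : Fin N → ℕ) : (Fin N → ℕ) → Type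
  | succeed : LOCCProtocol t t
  | fail {d : Fin N → ℕ} : LOCCProtocol t d
  | round {d : Fin N → ℕ} (i : Fin N) (I : LocalInstrument d i)
      (next : ∀ m : Fin I.numOutcomes, LOCCProtocol t (I.outDim m)) : LOCCProtocol t d

/-- The unnormalized final state conditioned on success, for the initial state `ρ`: its trace is the
probability of success (for `ρ` normalized). -/
def LOCCProtocol.successState {N : ℕ} {t : Fin N → ℕ} : {d : Fin N → ℕ} → LOCCProtocol t d →
    Matrix (Conf d) (Conf d) ℂ → Matrix (Conf t) (Conf t) ℂ
  | _, .succeed, ρ => ρ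
  | _, .fail, _ => 0
  | _, .round _ I next, ρ => ∑ m, (next m).successState (I.apply m ρ)

/-- `ψ` can be converted into `χ` by LOCC with probability `p`: some protocol declares success with
probability `p`, and in that case the parties share the state `χ`. -/
def ConvertibleWithProb {N : ℕ} {d t : Fin N → ℕ} (ψ : PartySpace d) (χ : PartySpace t)
    (p : ℝ) : Prop :=
  ∃ P : LOCCProtocol t d, P.successState (ketBra ψ) = (p : ℂ) • ketBra χ

/-- Convertibility by stochastic LOCC: conversion with some nonzero probability. -/
def SLOCCConvertible {N : ℕ} {d t : Fin N → ℕ} (ψ : PartySpace d) (χ : PartySpace t) : Prop :=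
  ∃ p : ℝ, 0 < p ∧ ConvertibleWithProb ψ χ p

end

/-! The value `E_k(ψ) = 1` is attained, so `ψ` is fixed by some `⊗ Γ i` with `Γ i` a projector of
rank `k i`. The success state of any LOCC protocol is a sum of terms `|v⟩⟨v|` with `v = (⊗ A i) ψ`;
if it equals `p |χ⟩⟨χ|` with `p > 0`, positivity makes a nonzero such `v` proportional to `χ`. Hence
`χ` is a multiple of `(⊗ A i Γ i) ψ`. Each `A i Γ i` has rank at most `k i`, so a projector of rank
exactly `k i` fixes its range; the product of these fixes `χ`, and `E_k(χ) = 1`. The key lemmas are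
`exists_tensorOp_mulVec_eq_self`, `SLOCCConvertible.exists_tensorOp` and
`Matrix.exists_isStarProjection_mul_eq_self`. -/

theorem tensorOp_mul {N : ℕ} {c d e : Fin N → ℕ} (A : ∀ i, Matrix (Fin (e i)) (Fin (d i)) ℂ)
    (B : ∀ i, Matrix (Fin (d i)) (Fin (c i)) ℂ) :
    tensorOp A * tensorOp B = tensorOp fun i => A i * B i := by
  ext x y
  simp only [Matrix.mul_apply, tensorOp, Matrix.of_apply, ← Finset.prod_mul_distrib]
  exact (Fintype.prod_sum fun i j => A i (x i) j * B i j (y i)).symm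

theorem tensorOp_one {N : ℕ} (d : Fin N → ℕ) :
    tensorOp (fun i => (1 : Matrix (Fin (d i)) (Fin (d i)) ℂ)) = 1 := by
  ext x y
  simp only [tensorOp, Matrix.of_apply, Matrix.one_apply, Finset.prod_ite_zero, funext_iff]
  simp

theorem conjTranspose_tensorOp {N : ℕ} {d e : Fin N → ℕ}
    (A : ∀ i, Matrix (Fin (e i)) (Fin (d i)) ℂ) :
    (tensorOp A)ᴴ = tensorOp fun i => (A i)ᴴ := by
  ext x y
  simp [tensorOp, Matrix.conjTranspose_apply]

theorem continuous_tensorOp {N : ℕ} {d e : Fin N → ℕ} :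
    Continuous (tensorOp : (∀ i, Matrix (Fin (e i)) (Fin (d i)) ℂ) → _) := by
  refine continuous_matrix fun x y => ?_
  simp only [tensorOp, Matrix.of_apply]
  fun_prop

theorem isStarProjection_tensorOp {N : ℕ} {d : Fin N → ℕ}
    {Γ : ∀ i, Matrix (Fin (d i)) (Fin (d i)) ℂ} (h : ∀ i, IsStarProjection (Γ i)) :
    IsStarProjection (tensorOp Γ) := by
  rw [isStarProjection_iff']
  constructor
  · rw [tensorOp_mul]
    exact congrArg _ (funext fun i => (h i).isIdempotentElem)
  · rw [Matrix.star_eq_conjTranspose, conjTranspose_tensorOp]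
    exact congrArg _ (funext fun i => (h i).isSelfAdjoint)

theorem IsStarProjection.norm_sq_mulVec_add {n : Type*} [Fintype n] [DecidableEq n]
    {P : Matrix n n ℂ} (hP : IsStarProjection P) (v : EuclideanSpace ℂ n) :
    ‖v‖ ^ 2 = ‖(WithLp.toLp 2 (P *ᵥ v.ofLp) : EuclideanSpace ℂ n)‖ ^ 2
      + ‖v - WithLp.toLp 2 (P *ᵥ v.ofLp)‖ ^ 2 := by
  have hT := hP.map (Matrix.toEuclideanCLM (n := n) (𝕜 := ℂ))
  obtain ⟨U, _, hU⟩ := isStarProjection_iff_eq_starProjection.mp hT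
  have hv : WithLp.toLp 2 (P *ᵥ v.ofLp) = U.starProjection v := by
    rw [← hU]; rfl
  rw [hv, U.norm_sq_eq_add_norm_sq_starProjection v, Submodule.starProjection_orthogonal_val]

theorem IsStarProjection.norm_apply_le_one {n : Type*} [Fintype n] [DecidableEq n]
    {P : Matrix n n ℂ} (hP : IsStarProjection P) (i j : n) : ‖P i j‖ ≤ 1 := by
  have h := hP.norm_sq_mulVec_add (EuclideanSpace.single j 1)
  have h2 := PiLp.norm_apply_le
    (WithLp.toLp 2 (P *ᵥ (EuclideanSpace.single j (1 : ℂ)).ofLp) : EuclideanSpace ℂ n) i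
  have h3 : (P *ᵥ (EuclideanSpace.single j (1 : ℂ)).ofLp) i = P i j := by
    simp [Matrix.mulVec_single]
  simp only [h3] at h2
  refine h2.trans ?_
  simp only [PiLp.norm_single, norm_one] at h
  nlinarith [sq_nonneg ‖EuclideanSpace.single j (1 : ℂ) -
    WithLp.toLp 2 (P *ᵥ (EuclideanSpace.single j (1 : ℂ)).ofLp)‖]

theorem IsIdempotentElem.trace_eq_rank {n : Type*} [Fintype n] [DecidableEq n]
    {P : Matrix n n ℂ} (hP : IsIdempotentElem P) : P.trace = P.rank := by
  have h : IsIdempotentElem (Matrix.toLin' P) := hP.map (Matrix.toLinAlgEquiv' (R := ℂ))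
  rw [← Matrix.trace_toLin'_eq, (LinearMap.IsIdempotentElem.isProj_range _ h).trace]
  rfl

/-- Rank is not continuous, but on projections it equals the trace, so the set is closed; it is
bounded because the entries of a projection have modulus at most 1. -/
theorem isCompact_setOf_isStarProjection_rank_eq {n : Type*} [Fintype n] [DecidableEq n] (k : ℕ) :
    IsCompact {P : Matrix n n ℂ | IsStarProjection P ∧ P.rank = k} := by
  have hc : IsCompact (Set.univ.pi fun _ : n => Set.univ.pi fun _ : n =>
      Metric.closedBall (0 : ℂ) 1) :=
    isCompact_univ_pi fun _ => isCompact_univ_pi fun _ => isCompact_closedBall _ _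
  refine IsCompact.of_isClosed_subset (X := Matrix n n ℂ) hc ?_ ?_
  · have : {P : Matrix n n ℂ | IsStarProjection P ∧ P.rank = k} =
        {P | P * P = P} ∩ {P | star P = P} ∩ {P | P.trace = (k : ℂ)} := by
      ext P
      simp only [Set.mem_ofPred_eq, Set.mem_inter_iff, ← isStarProjection_iff']
      refine and_congr_right fun h => ?_
      rw [h.isIdempotentElem.trace_eq_rank, Nat.cast_inj]
    rw [this]
    refine ((isClosed_eq ?_ ?_).inter (isClosed_eq ?_ ?_)).inter (isClosed_eq ?_ ?_)
    · exact continuous_id.matrix_mul continuous_id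
    · exact continuous_id
    · exact continuous_id.matrix_conjTranspose
    · exact continuous_id
    · exact continuous_id.matrix_trace
    · exact continuous_const
  · intro P hP i _ j _
    simpa using hP.1.norm_apply_le_one i j

theorem isCompact_projectionValues {N : ℕ} {d : Fin N → ℕ} (k : Fin N → ℕ) (ψ : PartySpace d) :
    IsCompact (projectionValues k ψ) := by
  have hc := isCompact_univ_pi fun i =>
    isCompact_setOf_isStarProjection_rank_eq (n := Fin (d i)) (k i)
  have hf : Continuous fun Γ : ∀ i, Matrix (Fin (d i)) (Fin (d i)) ℂ =>
      ‖(WithLp.toLp 2 (tensorOp Γ *ᵥ ψ.ofLp) : PartySpace d)‖ ^ 2 :=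
    ((PiLp.continuous_toLp 2 _).comp
      (continuous_tensorOp.matrix_mulVec continuous_const)).norm.pow 2
  convert hc.image hf using 1
  ext r
  simp [projectionValues, eq_comm]

theorem exists_tensorOp_mulVec_eq_self {N : ℕ} {d k : Fin N → ℕ} {ψ : PartySpace d}
    (hψ : ‖ψ‖ = 1) (hE : multiE k ψ = 1) :
    ∃ Γ : ∀ i, Matrix (Fin (d i)) (Fin (d i)) ℂ,
      (∀ i, (Γ i).rank = k i) ∧ tensorOp Γ *ᵥ ψ.ofLp = ψ.ofLp := by
  have hne : (projectionValues k ψ).Nonempty := by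
    -- `sSup ∅ = 0` in `ℝ`, so an empty set of values would contradict `hE`.
    by_contra h
    rw [Set.not_nonempty_iff_eq_empty] at h
    simp [multiE, h] at hE
  obtain ⟨Γ, hΓ, h⟩ := (isCompact_projectionValues k ψ).sSup_mem hne
  refine ⟨Γ, fun i => (hΓ i).2, ?_⟩
  have h2 := (isStarProjection_tensorOp fun i => (hΓ i).1).norm_sq_mulVec_add ψ
  rw [← h, ← multiE, hE, hψ] at h2
  have h3 : ‖ψ - WithLp.toLp 2 (tensorOp Γ *ᵥ ψ.ofLp)‖ = 0 := by
    rw [← sq_eq_zero_iff]; linarith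
  exact (congrArg WithLp.ofLp (sub_eq_zero.mp (norm_eq_zero.mp h3))).symm

theorem multiE_eq_one_of_tensorOp_mulVec_eq_self {N : ℕ} {d k : Fin N → ℕ} {ψ : PartySpace d}
    (hψ : ‖ψ‖ = 1) {Γ : ∀ i, Matrix (Fin (d i)) (Fin (d i)) ℂ}
    (hΓ : ∀ i, IsStarProjection (Γ i) ∧ (Γ i).rank = k i)
    (h : tensorOp Γ *ᵥ ψ.ofLp = ψ.ofLp) : multiE k ψ = 1 := by
  refine IsGreatest.csSup_eq ⟨⟨Γ, hΓ, ?_⟩, ?_⟩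
  · rw [h]
    simp [hψ]
  · rintro r ⟨Γ', hΓ', rfl⟩
    have h2 := (isStarProjection_tensorOp fun i => (hΓ' i).1).norm_sq_mulVec_add ψ
    rw [hψ] at h2
    nlinarith [sq_nonneg ‖ψ - WithLp.toLp 2 (tensorOp Γ' *ᵥ ψ.ofLp)‖]

theorem Submodule.exists_le_finrank_eq {K V : Type*} [Field K] [AddCommGroup V] [Module K V]
    [FiniteDimensional K V] (U : Submodule K V) {k : ℕ} (hU : Module.finrank K U ≤ k)
    (hk : k ≤ Module.finrank K V) : ∃ W : Submodule K V, U ≤ W ∧ Module.finrank K W = k := by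
  induction k, hU using Nat.le_induction with
  | base => exact ⟨U, le_rfl, rfl⟩
  | succ k _ ih =>
    obtain ⟨W, hUW, hW⟩ := ih (by omega)
    obtain ⟨x, hx⟩ : ∃ x, x ∉ W := by
      by_contra! h
      rw [← Submodule.eq_top_iff'] at h
      rw [h, finrank_top] at hW
      omega
    refine ⟨W ⊔ Submodule.span K {x}, hUW.trans le_sup_left, le_antisymm ?_ ?_⟩
    · have h1 := Submodule.finrank_add_le_finrank_add_finrank W (Submodule.span K {x})
      have h2 := finrank_span_le_card (R := K) ({x} : Set V)
      simp only [Set.toFinset_singleton, Finset.card_singleton] at h2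
      omega
    · have hlt : W < W ⊔ Submodule.span K {x} := by
        refine lt_of_le_of_ne le_sup_left fun h => hx ?_
        rw [h]
        exact Submodule.mem_sup_right (Submodule.mem_span_singleton_self x)
      have := Submodule.finrank_lt_finrank_of_lt hlt
      omega

theorem rank_eq_finrank_range_toEuclideanLin {m n : Type*} [Fintype m] [Fintype n]
    [DecidableEq n] (M : Matrix m n ℂ) :
    M.rank = Module.finrank ℂ (LinearMap.range (Matrix.toEuclideanLin M)) := by
  rw [Matrix.toEuclideanLin_eq_toLin_orthonormal]
  exact M.rank_eq_finrank_range_toLin _ _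

/-- Enlarge the range of `M` to a `k`-dimensional subspace and project onto it: the rank must be
exactly `k`, even where `M` has smaller rank. -/
theorem Matrix.exists_isStarProjection_mul_eq_self {m n : Type*} [Fintype m] [DecidableEq m]
    [Fintype n] [DecidableEq n] (M : Matrix m n ℂ) {k : ℕ} (hM : M.rank ≤ k)
    (hk : k ≤ Fintype.card m) :
    ∃ P : Matrix m m ℂ, (IsStarProjection P ∧ P.rank = k) ∧ P * M = M := by
  obtain ⟨W, hMW, hW⟩ := (LinearMap.range (Matrix.toEuclideanLin M)).exists_le_finrank_eq
    (k := k) (by rwa [← rank_eq_finrank_range_toEuclideanLin]) (by simpa using hk)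
  let T := W.starProjection
  obtain ⟨P, hPT⟩ := EquivLike.surjective (Matrix.toEuclideanCLM (n := m) (𝕜 := ℂ)) T
  have hP : IsStarProjection P := by
    have hT : IsStarProjection T := isStarProjection_starProjection
    rw [isStarProjection_iff', ← hPT, ← map_mul, ← map_star] at hT
    exact isStarProjection_iff'.mpr ⟨EquivLike.injective _ hT.1, EquivLike.injective _ hT.2⟩
  refine ⟨P, ⟨hP, ?_⟩, ?_⟩
  · rw [rank_eq_finrank_range_toEuclideanLin,
      ← Matrix.coe_toEuclideanCLM_eq_toEuclideanLin, hPT, ← hW]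
    exact congrArg (fun S : Submodule ℂ (EuclideanSpace ℂ m) => Module.finrank ℂ S)
      W.range_starProjection
  · refine Matrix.toLin'.injective (LinearMap.ext fun v => ?_)
    have hv : T (Matrix.toEuclideanLin M (WithLp.toLp 2 v)) =
        Matrix.toEuclideanLin M (WithLp.toLp 2 v) :=
      Submodule.starProjection_eq_self_iff.mpr (hMW ⟨_, rfl⟩)
    rw [← hPT] at hv
    have h := congrArg WithLp.ofLp hv
    simpa [Matrix.toLpLin_apply] using h

/-- Sums of states obtained from `φ` by product operators. -/
def separableImages {N : ℕ} {d : Fin N → ℕ} (φ : PartySpace d) (e : Fin N → ℕ) :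
    AddSubmonoid (Matrix (Conf e) (Conf e) ℂ) :=
  AddSubmonoid.closure {σ | ∃ A : ∀ i, Matrix (Fin (e i)) (Fin (d i)) ℂ,
    σ = ketBra (WithLp.toLp 2 (tensorOp A *ᵥ φ.ofLp))}

theorem mul_ketBra_mul_conjTranspose {N : ℕ} {d e : Fin N → ℕ} (M : Matrix (Conf e) (Conf d) ℂ)
    (ψ : PartySpace d) : M * ketBra ψ * Mᴴ = ketBra (WithLp.toLp 2 (M *ᵥ ψ.ofLp)) := by
  simp [ketBra, Matrix.mul_vecMulVec, Matrix.vecMulVec_mul, Matrix.star_mulVec]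

theorem tensorOp_conj_mem_separableImages {N : ℕ} {d e f : Fin N → ℕ} {φ : PartySpace d}
    (A : ∀ i, Matrix (Fin (f i)) (Fin (e i)) ℂ) {σ : Matrix (Conf e) (Conf e) ℂ}
    (hσ : σ ∈ separableImages φ e) :
    tensorOp A * σ * (tensorOp A)ᴴ ∈ separableImages φ f := by
  induction hσ using AddSubmonoid.closure_induction with
  | mem σ h =>
    obtain ⟨B, rfl⟩ := h
    refine AddSubmonoid.subset_closure ⟨fun i => A i * B i, ?_⟩
    rw [mul_ketBra_mul_conjTranspose, ← tensorOp_mul, Matrix.mulVec_mulVec]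
  | zero => simp
  | add σ τ _ _ hσ hτ =>
    rw [Matrix.mul_add, Matrix.add_mul]
    exact add_mem hσ hτ

theorem LOCCProtocol.successState_mem_separableImages {N : ℕ} {c d t : Fin N → ℕ}
    (φ : PartySpace c) (P : LOCCProtocol t d) {ρ : Matrix (Conf d) (Conf d) ℂ}
    (hρ : ρ ∈ separableImages φ d) : P.successState ρ ∈ separableImages φ t := by
  induction P with
  | succeed => exact hρ
  | fail => exact zero_mem _
  | round i I next ih =>
    -- Each Kraus operator acts as a `tensorOp` by definition; sums over Kraus operators and
    -- outcomes stay in the submonoid.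
    exact sum_mem fun m _ => ih m (sum_mem fun s _ => tensorOp_conj_mem_separableImages _ hρ)

-- Positivity is carried through the induction so that adding further terms preserves domination of
-- the chosen one.
open scoped ComplexOrder in
theorem exists_posSemidef_sub_ketBra {N : ℕ} {d e : Fin N → ℕ} {φ : PartySpace d}
    {σ : Matrix (Conf e) (Conf e) ℂ} (hσ : σ ∈ separableImages φ e) :
    σ.PosSemidef ∧ (σ ≠ 0 → ∃ A : ∀ i, Matrix (Fin (e i)) (Fin (d i)) ℂ,
      tensorOp A *ᵥ φ.ofLp ≠ 0 ∧
      (σ - ketBra (WithLp.toLp 2 (tensorOp A *ᵥ φ.ofLp))).PosSemidef) := by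
  induction hσ using AddSubmonoid.closure_induction with
  | mem σ h =>
    obtain ⟨A, rfl⟩ := h
    refine ⟨Matrix.posSemidef_vecMulVec_self_star _, fun h => ⟨A, fun h0 => h ?_, ?_⟩⟩
    · simp [ketBra, h0]
    · rw [sub_self]
      exact .zero
  | zero => exact ⟨.zero, fun h => absurd rfl h⟩
  | add σ τ _ _ hσ hτ =>
    refine ⟨hσ.1.add hτ.1, fun h => ?_⟩
    by_cases h0 : σ = 0
    · subst h0
      simpa using hτ.2 (by simpa using h)
    · obtain ⟨A, hA, hA'⟩ := hσ.2 h0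
      refine ⟨A, hA, ?_⟩
      rw [add_sub_right_comm]
      exact hA'.add hτ.1

open scoped ComplexOrder in
theorem eq_inner_smul_of_posSemidef_sub_ketBra {N : ℕ} {t : Fin N → ℕ} {χ v : PartySpace t}
    (hχ : ‖χ‖ = 1) {p : ℂ} (h : (p • ketBra χ - ketBra v).PosSemidef) :
    v = inner ℂ χ v • χ := by
  -- On the component `w` of `v` orthogonal to `χ`, the positive form takes the value `-|⟨w, v⟩|²`.
  -- So `⟨w, v⟩ = 0`, which forces `w = 0`.
  set w := v - inner ℂ χ v • χ with hw
  have hwχ : inner ℂ χ w = 0 := by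
    simp [hw, inner_self_eq_norm_sq_to_K, hχ]
  have hq (u : PartySpace t) :
      star w.ofLp ⬝ᵥ (ketBra u *ᵥ w.ofLp) = (inner ℂ w u) * (inner ℂ u w) := by
    rw [ketBra, Matrix.vecMulVec_mulVec, EuclideanSpace.inner_eq_star_dotProduct,
      EuclideanSpace.inner_eq_star_dotProduct]
    simp [dotProduct_comm, mul_comm]
  have h1 := h.dotProduct_mulVec_nonneg w.ofLp
  rw [Matrix.sub_mulVec, Matrix.smul_mulVec, dotProduct_sub, dotProduct_smul, hq, hq, hwχ,
    mul_zero, smul_zero, zero_sub,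
    ← inner_conj_symm v w, RCLike.mul_conj] at h1
  have hwv : inner ℂ w v = 0 := by
    have h2 : (0 : ℝ) ≤ -‖inner ℂ w v‖ ^ 2 := by
      rw [← Complex.zero_le_real]
      push_cast
      exact h1
    rw [← norm_eq_zero, ← sq_eq_zero_iff]
    exact le_antisymm (by linarith) (sq_nonneg _)
  have hww : inner ℂ w w = 0 := by
    conv_lhs => enter [3]; rw [hw]
    rw [inner_sub_right, inner_smul_right, hwv, inner_eq_zero_symm.mp hwχ]
    simp
  exact sub_eq_zero.mp (inner_self_eq_zero.mp hww)

theorem SLOCCConvertible.exists_tensorOp {N : ℕ} {d t : Fin N → ℕ} {ψ : PartySpace d}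
    {χ : PartySpace t} (hχ : ‖χ‖ = 1) (h : SLOCCConvertible ψ χ) :
    ∃ (A : ∀ i, Matrix (Fin (t i)) (Fin (d i)) ℂ) (c : ℂ), χ.ofLp = c • (tensorOp A *ᵥ ψ.ofLp) := by
  obtain ⟨p, hp, P, hP⟩ := h
  have hmem : (p : ℂ) • ketBra χ ∈ separableImages ψ t := by
    rw [← hP]
    refine P.successState_mem_separableImages ψ (AddSubmonoid.subset_closure
      ⟨fun i => 1, ?_⟩)
    rw [tensorOp_one, Matrix.one_mulVec]
  have hne : (p : ℂ) • ketBra χ ≠ 0 := by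
    refine smul_ne_zero (by exact_mod_cast hp.ne') ?_
    have hχ0 : χ.ofLp ≠ 0 := by
      intro h0
      have : χ = 0 := by ext i; simp [h0]
      simp [this] at hχ
    simpa [ketBra, Matrix.vecMulVec_eq_zero] using hχ0
  obtain ⟨A, hA, hA'⟩ := (exists_posSemidef_sub_ketBra hmem).2 hne
  have hv := congrArg WithLp.ofLp (eq_inner_smul_of_posSemidef_sub_ketBra hχ hA')
  set c := inner ℂ χ (WithLp.toLp 2 (tensorOp A *ᵥ ψ.ofLp)) with hc
  simp only [WithLp.ofLp_smul] at hv
  have hc0 : c ≠ 0 := fun h0 => hA (by rw [hv, h0, zero_smul])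
  exact ⟨A, c⁻¹, by rw [hv, inv_smul_smul₀ hc0]⟩

theorem corollary11 {N : ℕ} (d t : Fin N → ℕ) (ψ : PartySpace d) (χ : PartySpace t)
    (hψ : ‖ψ‖ = 1) (hχ : ‖χ‖ = 1)
    (k : Fin N → ℕ) (hk : ∀ i, 1 ≤ k i) (hkd : ∀ i, k i ≤ d i) (hkt : ∀ i, k i ≤ t i)
    (hEψ : multiE k ψ = 1) (hEχ : multiE k χ ≠ 1) :
    ¬ SLOCCConvertible ψ χ := by
  intro h
  obtain ⟨A, c, hA⟩ := h.exists_tensorOp hχ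
  obtain ⟨Γ, hΓ, hΓψ⟩ := exists_tensorOp_mulVec_eq_self hψ hEψ
  have hex (i : Fin N) := (A i * Γ i).exists_isStarProjection_mul_eq_self (k := k i)
    ((Matrix.rank_mul_le_right _ _).trans (hΓ i).le) (by simpa using hkt i)
  choose Q hQ hQA using hex
  refine hEχ (multiE_eq_one_of_tensorOp_mulVec_eq_self hχ hQ ?_)
  have h1 : tensorOp A *ᵥ ψ.ofLp = tensorOp (fun i => A i * Γ i) *ᵥ ψ.ofLp := by
    rw [← tensorOp_mul, ← Matrix.mulVec_mulVec, hΓψ]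
  rw [hA, Matrix.mulVec_smul, h1, Matrix.mulVec_mulVec, tensorOp_mul]
  simp only [hQA]
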